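/- All graphs are finite and simple. A tree decomposition of a graph $G$ consists of a tree $T$ and a (nonempty) subtree $S_v$ of $T$ for each vertex $v$ of $G$ such that $V(S_u)\cap V(S_v)\neq\emptyset$ whenever $uv\in E(G)$; its width is the maximum over the nodes $t$ of $T$ of $|\{v : t\in V(S_v)\}|-1$. The treewidth of $G$ is the minimum width of a tree decomposition of $G$. For a graph $H$, let $f(H)$ be the minimum integer $k$ such that every graph that does not contain $H$ as a minor has treewidth at most $k$, with $f(H)=\infty$ if there is no such integer. (Here $H$ is a minor of $G$ if there are pairwise disjoint nonempty sets $B_w\subseteq V(G)$, one for each $w\in V(H)$, each inducing a connected subgraph of $G$, such that $G$ has an edge between $B_u$ and $B_w$ whenever $uw\in E(H)$.) Proposition. For every real $c>0$ there is a real $d>0$ such that, for every graph $H$ with at least two vertices, if $f(H)\le c\,|V(H)|$, then $H$ contains at most $\dfrac{d\,|V(H)|}{\log |V(H)|}$ pairwise vertex-disjoint cycles. -/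

import Mathlib

open scoped ENNReal

namespace SimpleGraph

/-- A tree decomposition of `G`: a finite tree `tree` and a subtree of it for each vertex of `G`,
such that the subtrees of adjacent vertices share a node. (The subtrees are given as nonempty
connected subgraphs of the tree, which are the same thing.) -/
structure TreeDecomposition {V : Type*} (G : SimpleGraph V) where
  Node : Type
  finite_node : Finite Node
  tree : SimpleGraph Node
  isTree : tree.IsTree
  subtree : V → tree.Subgraph
  subtree_connected : ∀ v, (subtree v).Connected
  inter_nonempty : ∀ u v, G.Adj u v → ((subtree u).verts ∩ (subtree v).verts).Nonempty

/-- The bag of a node `t`: the vertices whose subtree contains `t`. -/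
def TreeDecomposition.bag {V : Type*} {G : SimpleGraph V} (D : G.TreeDecomposition)
    (t : D.Node) : Set V :=
  {v | t ∈ (D.subtree v).verts}

/-- The width of a tree decomposition: the maximum of `|bag t| - 1` over the nodes `t`.
(An empty bag contributes `0`, so the graph without vertices gets treewidth `0`.) -/
noncomputable def TreeDecomposition.width {V : Type*} {G : SimpleGraph V}
    (D : G.TreeDecomposition) : ℕ∞ :=
  ⨆ t : D.Node, ((D.bag t).encard - 1)

/-- The treewidth of a (finite) graph: the minimum width of its tree decompositions. -/
noncomputable def treewidth {V : Type*} (G : SimpleGraph V) : ℕ∞ :=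
  ⨅ D : G.TreeDecomposition, D.width

/-- `H` is (isomorphic to) a minor of `G`: there are pairwise disjoint nonempty connected branch
sets in `G`, one for each vertex of `H`, with an edge of `G` between the branch sets of any two
adjacent vertices of `H`. -/
def IsMinor {W V : Type*} (H : SimpleGraph W) (G : SimpleGraph V) : Prop :=
  ∃ B : W → Set V,
    (∀ w, (G.induce (B w)).Connected) ∧
    (∀ u w, u ≠ w → Disjoint (B u) (B w)) ∧
    (∀ u w, H.Adj u w → ∃ x ∈ B u, ∃ y ∈ B w, G.Adj x y)

/-- The function `f(H)`: the least `k` such that every finite graph that does not contain `H` as a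
minor has treewidth at most `k`, and `⊤` if there is no such integer. Finite graphs are taken up
to isomorphism, on the vertex sets `Fin n`. -/
noncomputable def minorTreewidthBound {W : Type*} (H : SimpleGraph W) : ℕ∞ :=
  sInf {k : ℕ∞ | ∀ (n : ℕ) (G : SimpleGraph (Fin n)), ¬ H.IsMinor G → G.treewidth ≤ k}

/-- `H` contains `k` (pairwise) vertex-disjoint cycles. -/
def HasDisjointCycles {W : Type*} (H : SimpleGraph W) (k : ℕ) : Prop :=
  ∃ (v : Fin k → W) (C : ∀ i, H.Walk (v i) (v i)),
    (∀ i, (C i).IsCycle) ∧ ∀ i j, i ≠ j → (C i).support.Disjoint (C j).support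

end SimpleGraph

/-! It suffices to find, for N = 75q with q of order |V(H)|, a graph G on N vertices with treewidth
at least q > c|V(H)| and only O(N / log N) disjoint cycles. The bound on f(H) makes H a minor of G,
and disjoint cycles of a minor lift to disjoint cycles of G (`IsMinor.hasDisjointCycles`).

G is a random graph of edge probability 1/q: pairs receive one of q colours and those of colour z
are the edges, so probabilities become exact counts of colourings. With positive probability
(`exists_colouring`) any two disjoint sets of at least N/5 vertices are joined by an edge, and
cycles of length at most L are few. The first property forces large treewidth, because small bags
give a balanced separation (`TreeDecomposition.exists_separated`). With L of order log N, the short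
cycles number O(√N), and disjoint longer cycles number at most N/(L+1). -/

namespace SimpleGraph

/-! ### Lifting disjoint cycles from a minor -/

variable {V W : Type*}

/-- The spanning subgraph of `G` consisting of the edges with both ends in `U`. -/
def restrictTo (G : SimpleGraph V) (U : Set V) : SimpleGraph V where
  Adj x y := G.Adj x y ∧ x ∈ U ∧ y ∈ U
  symm := ⟨fun _ _ h => ⟨h.1.symm, h.2.2, h.2.1⟩⟩
  loopless := ⟨fun _ h => G.loopless.irrefl _ h.1⟩

lemma restrictTo_le (G : SimpleGraph V) (U : Set V) : G.restrictTo U ≤ G := fun _ _ h => h.1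

lemma Walk.support_subset_of_restrictTo {G : SimpleGraph V} {U : Set V} {u v : V}
    (p : (G.restrictTo U).Walk u v) (hu : u ∈ U) : ∀ x ∈ p.support, x ∈ U := by
  induction p with
  | nil => simpa using hu
  | cons h p ih =>
    intro x hx
    rw [Walk.support_cons, List.mem_cons] at hx
    rcases hx with rfl | hx
    · exact hu
    · exact ih h.2.2 x hx

/-- Following a walk of `H` through branch sets, avoiding the edge `e` of `H`. -/
lemma Walk.reachable_of_branchSets {H : SimpleGraph W} {K : SimpleGraph V} {B : W → Set V}
    {S : Set W} {e : Sym2 W}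
    (h1 : ∀ w ∈ S, ∀ x ∈ B w, ∀ y ∈ B w, K.Reachable x y)
    (h2 : ∀ u ∈ S, ∀ w ∈ S, H.Adj u w → s(u, w) ≠ e → ∃ x ∈ B u, ∃ y ∈ B w, K.Adj x y)
    {u w : W} (p : H.Walk u w) (hS : ∀ x ∈ p.support, x ∈ S) (he : e ∉ p.edges)
    {x y : V} (hx : x ∈ B u) (hy : y ∈ B w) : K.Reachable x y := by
  induction p generalizing x with
  | nil => exact h1 _ (hS _ (by simp)) _ hx _ hy
  | cons h p ih =>
    rw [Walk.edges_cons, List.mem_cons, not_or] at he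
    obtain ⟨x', hx', y', hy', hadj⟩ := h2 _ (hS _ (by simp)) _ (hS _ (by simp)) h (Ne.symm he.1)
    exact (h1 _ (hS _ (by simp)) _ hx _ hx').trans (hadj.reachable.trans
      (ih (fun z hz => hS z (by simp [hz])) he.2 hy' hy))

/-- A cycle in a minor of `G` yields a cycle of `G` in the union of its branch sets. -/
lemma Walk.IsCycle.exists_cycle_of_branchSets {H : SimpleGraph W} {G : SimpleGraph V}
    {B : W → Set V} (hconn : ∀ w, (G.induce (B w)).Connected)
    (hdisj : ∀ u w, u ≠ w → Disjoint (B u) (B w))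
    (hadj : ∀ u w, H.Adj u w → ∃ x ∈ B u, ∃ y ∈ B w, G.Adj x y)
    {w : W} {p : H.Walk w w} (hp : p.IsCycle) :
    ∃ (v : V) (C : G.Walk v v), C.IsCycle ∧
      ∀ x ∈ C.support, ∃ u ∈ p.support, x ∈ B u := by
  cases p with
  | nil => exact absurd hp (by simp)
  | @cons _ u _ h q =>
    rw [Walk.cons_isCycle_iff] at hp
    set S : Set W := {x | x ∈ (Walk.cons h q).support} with hS
    set U : Set V := {x | ∃ u ∈ S, x ∈ B u} with hU
    obtain ⟨a, ha, b, hb, hab⟩ := hadj _ _ h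
    have hwS : w ∈ S := by simp [hS]
    have huS : u ∈ S := by simp [hS]
    have key : ∀ {x y : W} {s t : V}, s ∈ B x → t ∈ B y → s(s, t) = s(a, b) →
        s(x, y) = s(w, u) := by
      have un : ∀ {x y : W} {s : V}, s ∈ B x → s ∈ B y → x = y := fun hx hy => by
        by_contra hne
        exact Set.disjoint_left.1 (hdisj _ _ hne) hx hy
      intro x y s t hs ht hst
      rcases Sym2.eq_iff.1 hst with ⟨rfl, rfl⟩ | ⟨rfl, rfl⟩
      · rw [un hs ha, un ht hb]
      · rw [un hs hb, un ht ha, Sym2.eq_swap]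
    -- The rest of the cycle avoids the edge `wu`. As branch sets are disjoint, its lift avoids
    -- `ab`, so `ab` lies on a cycle inside `U`.
    have hreach : ((G.restrictTo U).deleteEdges {s(a, b)}).Reachable b a := by
      refine Walk.reachable_of_branchSets (S := S) (B := B) (e := s(w, u)) ?_ ?_ q
        (fun x hx => by simp [hS, hx]) hp.2 hb ha
      · intro z hz x hx y hy
        obtain ⟨r⟩ := (hconn z).preconnected ⟨x, hx⟩ ⟨y, hy⟩
        refine ⟨r.map ⟨Subtype.val, ?_⟩⟩
        intro s t hst
        rw [deleteEdges_adj]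
        refine ⟨⟨hst, ⟨z, hz, s.2⟩, ⟨z, hz, t.2⟩⟩, fun hmem => ?_⟩
        have := key s.2 t.2 hmem
        have hne := h.ne
        rcases Sym2.eq_iff.1 this with ⟨h1, h2⟩ | ⟨h1, h2⟩
        · exact hne (h1.symm.trans h2)
        · exact hne (h2.symm.trans h1)
      · intro x hx y hy hxy hne
        obtain ⟨s, hs, t, ht, hst⟩ := hadj _ _ hxy
        refine ⟨s, hs, t, ht, ?_⟩
        rw [deleteEdges_adj]
        exact ⟨⟨hst, ⟨x, hx, hs⟩, ⟨y, hy, ht⟩⟩, fun hmem => hne (key hs ht hmem)⟩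
    obtain ⟨v, C, hC, -⟩ := adj_and_reachable_delete_edges_iff_exists_cycle.1
      ⟨(⟨hab, ⟨w, hwS, ha⟩, ⟨u, huS, hb⟩⟩ : (G.restrictTo U).Adj a b), hreach.symm⟩
    have hv : v ∈ U := by
      cases C with
      | nil => exact absurd hC (by simp)
      | cons h' _ => exact h'.2.1
    refine ⟨v, C.mapLe (restrictTo_le G U), hC.mapLe _, fun x hx => ?_⟩
    have hx' : x ∈ C.support := by simpa using hx
    exact C.support_subset_of_restrictTo hv x hx'

lemma IsMinor.hasDisjointCycles {H : SimpleGraph W} {G : SimpleGraph V} (hm : H.IsMinor G)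
    {k : ℕ} (hk : H.HasDisjointCycles k) : G.HasDisjointCycles k := by
  obtain ⟨B, hconn, hdisj, hadj⟩ := hm
  obtain ⟨v, C, hC, hCd⟩ := hk
  choose v' C' hC' hsupp using fun i =>
    (hC i).exists_cycle_of_branchSets hconn hdisj hadj
  refine ⟨v', C', hC', fun i j hij x hxi hxj => ?_⟩
  obtain ⟨u, hu, hxu⟩ := hsupp i x hxi
  obtain ⟨w, hw, hxw⟩ := hsupp j x hxj
  have huw : u ≠ w := fun h => hCd i j hij hu (h ▸ hw)
  exact Set.disjoint_left.1 (hdisj _ _ huw) hxu hxw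

end SimpleGraph

/-! ### Balanced separations from tree decompositions -/

namespace SimpleGraph

variable {V : Type*}

/-- If no fibre of `f` on `X` contains more than half of `N` points, then the fibres can be divided
into two groups both of which are large. -/
lemma exists_balanced_fibers {K : Type*} [Fintype K] [DecidableEq K] (X : Finset V)
    (f : V → K) {N : ℕ} (hX : 9 * N ≤ 10 * X.card)
    (hf : ∀ κ, 2 * (X.filter (f · = κ)).card ≤ N) :
    ∃ S : Finset K, N ≤ 5 * (X.filter (f · ∈ S)).card ∧ N ≤ 5 * (X.filter (f · ∉ S)).card := by
  classical
  -- By minimality, `S` covers fewer than N/5 + N/2 points, leaving at least 9N/10 - 7N/10 = N/5.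
  obtain ⟨S, hS⟩ := (Set.toFinite {S : Finset K | N ≤ 5 * (X.filter (f · ∈ S)).card}).exists_minimal
    ⟨Finset.univ, by simp; omega⟩
  refine ⟨S, hS.prop, ?_⟩
  have hsplit : (X.filter (f · ∈ S)).card + (X.filter (f · ∉ S)).card = X.card :=
    Finset.card_filter_add_card_filter_not _
  rcases S.eq_empty_or_nonempty with rfl | ⟨κ, hκ⟩
  · simp only [Finset.notMem_empty, not_false_eq_true, Finset.filter_true]
    omega
  have hlt : 5 * (X.filter (f · ∈ S.erase κ)).card < N := by
    by_contra hcon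
    have := hS.le_of_le (y := S.erase κ) (by simpa using hcon) (Finset.erase_subset _ _)
    exact Finset.notMem_erase κ S (this hκ)
  have hle : (X.filter (f · ∈ S)).card ≤
      (X.filter (f · ∈ S.erase κ)).card + (X.filter (f · = κ)).card := by
    refine (Finset.card_le_card fun x hx => ?_).trans (Finset.card_union_le _ _)
    simp only [Finset.mem_union, Finset.mem_filter, Finset.mem_erase] at hx ⊢
    tauto
  have := hf κ
  omega

namespace TreeDecomposition

variable {G : SimpleGraph V}

/-- A node of the subtree of `v`. -/
noncomputable def base (D : G.TreeDecomposition) (v : V) : D.Node :=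
  (D.subtree_connected v).nonempty.choose

lemma base_mem (D : G.TreeDecomposition) (v : V) : D.base v ∈ (D.subtree v).verts :=
  (D.subtree_connected v).nonempty.choose_spec

/-- A subtree avoiding the node `t` is connected in `D.tree` minus `t`. -/
lemma reachable_of_notMem_bag (D : G.TreeDecomposition) {t : D.Node} {v : V} (hv : v ∉ D.bag t)
    {x y : D.Node} (hx : x ∈ (D.subtree v).verts) (hy : y ∈ (D.subtree v).verts) :
    (D.tree.deleteIncidenceSet t).Reachable x y := by
  obtain ⟨r⟩ := (D.subtree_connected v).coe.preconnected ⟨x, hx⟩ ⟨y, hy⟩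
  refine ⟨r.map ⟨Subtype.val, ?_⟩⟩
  intro a b hab
  rw [deleteIncidenceSet_adj]
  exact ⟨(D.subtree v).adj_sub hab, fun h => hv (h ▸ a.2), fun h => hv (h ▸ b.2)⟩

/-- The component of `D.tree` minus `t` containing the subtree of `v`, if `v ∉ D.bag t`. -/
noncomputable def side (D : G.TreeDecomposition) (t : D.Node) (v : V) :
    (D.tree.deleteIncidenceSet t).ConnectedComponent :=
  (D.tree.deleteIncidenceSet t).connectedComponentMk (D.base v)

lemma side_eq_of_adj (D : G.TreeDecomposition) {t : D.Node} {u v : V} (h : G.Adj u v)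
    (hu : u ∉ D.bag t) (hv : v ∉ D.bag t) : D.side t u = D.side t v := by
  obtain ⟨x, hxu, hxv⟩ := D.inter_nonempty u v h
  exact ConnectedComponent.eq.2 ((D.reachable_of_notMem_bag hu (D.base_mem u) hxu).trans
    (D.reachable_of_notMem_bag hv hxv (D.base_mem v)))

end TreeDecomposition

lemma not_reachable_deleteIncidenceSet {N : Type*} {T : SimpleGraph N} {t x : N} (h : x ≠ t) :
    ¬ (T.deleteIncidenceSet t).Reachable x t := by
  rintro ⟨p⟩
  cases hp : p.reverse with
  | nil => exact h rfl
  | cons hadj _ => exact (deleteIncidenceSet_adj.1 hadj).2.1 rfl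

/-- A walk avoiding `t'` that does not lead into the component of `t` avoids `t`. -/
lemma reachable_deleteIncidenceSet_of_not_reachable {N : Type*} {T : SimpleGraph N} {t t' u x : N}
    (hu : ¬ (T.deleteIncidenceSet t').Reachable u t)
    (hx : (T.deleteIncidenceSet t').Reachable u x) :
    (T.deleteIncidenceSet t).Reachable u x := by
  obtain ⟨p⟩ := hx
  induction p with
  | nil => rfl
  | cons h p ih =>
    have hv := fun hv => hu (h.reachable.trans hv)
    refine Reachable.trans (Adj.reachable ?_) (ih hv)
    rw [deleteIncidenceSet_adj]
    exact ⟨(deleteIncidenceSet_le _ _) h, fun e => hu (e ▸ .rfl), fun e => hv (e ▸ .rfl)⟩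

lemma deleteIncidenceSet_le_deleteEdges {N : Type*} (T : SimpleGraph N) {t : N} {e : Sym2 N}
    (h : t ∈ e) : T.deleteIncidenceSet t ≤ T.deleteEdges {e} := by
  intro a b hab
  rw [deleteIncidenceSet_adj] at hab
  rw [deleteEdges_adj]
  refine ⟨hab.1, fun he => ?_⟩
  rw [Set.mem_singleton_iff] at he
  subst he
  rcases Sym2.mem_iff.1 h with rfl | rfl
  · exact hab.2.1 rfl
  · exact hab.2.2 rfl

/-- Some node of a tree decomposition leaves no component with more than half of the vertices. -/
lemma TreeDecomposition.exists_centroid [Fintype V] {G : SimpleGraph V}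
    (D : G.TreeDecomposition) :
    ∃ t : D.Node, ∀ κ : (D.tree.deleteIncidenceSet t).ConnectedComponent,
      2 * Set.ncard {v | v ∉ D.bag t ∧ D.side t v = κ} ≤ Fintype.card V := by
  classical
  by_contra! hcon
  have := D.finite_node
  have hne : Nonempty D.Node := D.isTree.connected.nonempty
  choose κ hκ using hcon
  -- Every node now has a component holding more than half of the vertices. From a node whose heavy
  -- component is smallest, a step to the neighbour `t'` inside it yields a strictly smaller one;
  -- two heavy components always share a vertex.
  obtain ⟨t, ht⟩ := Finite.exists_min fun t => (κ t).supp.ncard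
  have hmeet : ∀ s t : D.Node, ∃ v, (v ∉ D.bag s ∧ D.side s v = κ s) ∧
      (v ∉ D.bag t ∧ D.side t v = κ t) := by
    intro s t
    by_contra! hno
    have hd : Disjoint {v | v ∉ D.bag s ∧ D.side s v = κ s} {v | v ∉ D.bag t ∧ D.side t v = κ t} :=
      Set.disjoint_left.2 fun v hv hv' => hno v hv hv'.1 hv'.2
    have h1 := Set.ncard_union_eq hd
    have h2 := Set.ncard_le_card
      ({v | v ∉ D.bag s ∧ D.side s v = κ s} ∪ {v | v ∉ D.bag t ∧ D.side t v = κ t})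
    rw [Nat.card_eq_fintype_card] at h2
    have := hκ s
    have := hκ t
    omega
  obtain ⟨v₀, ⟨hv₀, hv₀κ⟩, -⟩ := hmeet t t
  have hbase : D.base v₀ ≠ t := fun h => hv₀ (h ▸ D.base_mem v₀)
  obtain ⟨p, hp⟩ := (D.isTree.connected.preconnected t (D.base v₀)).exists_isPath
  cases p with
  | nil => exact hbase rfl
  | @cons _ t' _ hadj p =>
    rw [Walk.cons_isPath_iff] at hp
    have ht'κ : (D.tree.deleteIncidenceSet t).Reachable t' (D.base v₀) := by
      refine ⟨p.transfer _ fun e he => ?_⟩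
      rw [edgeSet_deleteIncidenceSet]
      exact ⟨p.edges_subset_edgeSet he, fun h => hp.2 (p.mem_support_of_mem_edges he h.2)⟩
    obtain ⟨v, ⟨hv, hvκ⟩, hv', hvκ'⟩ := hmeet t t'
    have hut' : D.base v ≠ t' := fun h => hv' (h ▸ D.base_mem v)
    have hr : (D.tree.deleteIncidenceSet t).Reachable t' (D.base v) :=
      ht'κ.trans (ConnectedComponent.eq.1 (hv₀κ.trans hvκ.symm))
    -- Otherwise `t` and `t'` would be joined without the edge `tt'`, which is a bridge.
    have hnr : ¬ (D.tree.deleteIncidenceSet t').Reachable (D.base v) t := by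
      intro h
      have hb := isAcyclic_iff_forall_adj_isBridge.1 D.isTree.isAcyclic hadj
      rw [isBridge_iff] at hb
      refine hb (Reachable.trans (Reachable.mono ?_ h.symm) (Reachable.mono ?_ hr.symm))
      · exact deleteIncidenceSet_le_deleteEdges _ (by simp)
      · exact deleteIncidenceSet_le_deleteEdges _ (by simp)
    have hss : (κ t').supp ⊂ (κ t).supp := by
      refine ⟨fun x hx => ?_, fun hsub => ?_⟩
      · rw [ConnectedComponent.mem_supp_iff, ← hvκ'] at hx
        rw [ConnectedComponent.mem_supp_iff, ← hvκ]
        exact ConnectedComponent.eq.2 (reachable_deleteIncidenceSet_of_not_reachable hnr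
          (ConnectedComponent.eq.1 hx).symm).symm
      · have hmem : t' ∈ (κ t).supp := by
          rw [ConnectedComponent.mem_supp_iff, ← hvκ]
          exact ConnectedComponent.eq.2 hr
        have := hsub hmem
        rw [ConnectedComponent.mem_supp_iff, ← hvκ'] at this
        exact not_reachable_deleteIncidenceSet hut' (ConnectedComponent.eq.1 this).symm
    exact absurd (ht t') (not_le.2 (Set.ncard_lt_ncard hss))

/-- A graph with a tree decomposition into small bags has two large sets without an edge between
them. -/
lemma TreeDecomposition.exists_separated [Fintype V] {G : SimpleGraph V}
    (D : G.TreeDecomposition) (hD : ∀ t, 10 * (D.bag t).ncard ≤ Fintype.card V) :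
    ∃ A B : Finset V, Disjoint A B ∧ (∀ a ∈ A, ∀ b ∈ B, ¬ G.Adj a b) ∧
      Fintype.card V ≤ 5 * A.card ∧ Fintype.card V ≤ 5 * B.card := by
  classical
  have := D.finite_node
  obtain ⟨t, ht⟩ := D.exists_centroid
  have := Fintype.ofFinite (D.tree.deleteIncidenceSet t).ConnectedComponent
  set X : Finset V := Finset.univ.filter (· ∉ D.bag t) with hX
  obtain ⟨S, hS₁, hS₂⟩ := exists_balanced_fibers X (D.side t) (N := Fintype.card V) (by
      have h1 := hD t
      have h2 : (Finset.univ.filter (· ∈ D.bag t)).card + X.card = Fintype.card V := by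
        rw [hX, Finset.card_filter_add_card_filter_not, Finset.card_univ]
      have h3 : (D.bag t).ncard = (Finset.univ.filter (· ∈ D.bag t)).card := by
        rw [← Set.ncard_coe_finset]; congr 1; ext; simp
      omega) (fun κ => by
      refine le_trans (le_of_eq ?_) (ht κ)
      rw [← Set.ncard_coe_finset]; congr 2; ext; simp [hX])
  refine ⟨_, _, Finset.disjoint_filter_filter_not X X (D.side t · ∈ S), ?_, hS₁, hS₂⟩
  intro a ha b hb hab
  simp only [hX, Finset.mem_filter, Finset.mem_univ, true_and] at ha hb
  exact hb.2 (D.side_eq_of_adj hab ha.1 hb.1 ▸ ha.2)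

end SimpleGraph

/-! ### Random colourings by counting -/

namespace SimpleGraph

/-- Counting the functions whose values on `F` are prescribed to lie in `P`. -/
lemma card_filter_forall_mem {ι Q : Type*} [Fintype ι] [DecidableEq ι] [Fintype Q] [DecidableEq Q]
    (F : Finset ι) (P : Finset Q) :
    (Finset.univ.filter fun g : ι → Q => ∀ e ∈ F, g e ∈ P).card * Fintype.card Q ^ F.card =
      P.card ^ F.card * Fintype.card Q ^ Fintype.card ι := by
  have h : (Finset.univ.filter fun g : ι → Q => ∀ e ∈ F, g e ∈ P) =
      Fintype.piFinset fun e => if e ∈ F then P else Finset.univ := by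
    ext g
    simp only [Finset.mem_filter, Finset.mem_univ, true_and, Fintype.mem_piFinset]
    refine forall_congr' fun e => ?_
    split_ifs with he <;> simp [he]
  rw [h, Fintype.card_piFinset]
  have : ∀ e, (if e ∈ F then P else Finset.univ).card =
      if e ∈ F then P.card else Fintype.card Q := fun e => by split_ifs <;> simp
  simp_rw [this]
  rw [Finset.prod_ite, Finset.prod_const, Finset.prod_const, mul_assoc, ← pow_add]
  have h2 := Finset.card_filter_add_card_filter_not (s := (Finset.univ : Finset ι)) (· ∈ F)
  rw [Finset.card_univ] at h2
  have h3 : (Finset.univ.filter (· ∈ F)) = F := by ext; simp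
  rw [h3] at h2 ⊢
  congr 2
  omega

variable {V Q : Type*}

/-- The graph on `V` whose edges are the pairs of colour `z`. -/
def colourGraph (z : Q) (g : Sym2 V → Q) : SimpleGraph V := fromEdgeSet {e | g e = z}

lemma colourGraph_adj {z : Q} {g : Sym2 V → Q} {u v : V} :
    (colourGraph z g).Adj u v ↔ g s(u, v) = z ∧ u ≠ v := by
  simp [colourGraph]

/-- The pairs between two sets of vertices. -/
def pairsBetween [DecidableEq V] (A B : Finset V) : Finset (Sym2 V) :=
  (A ×ˢ B).image fun p => s(p.1, p.2)

lemma card_pairsBetween [DecidableEq V] {A B : Finset V} (h : Disjoint A B) :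
    (pairsBetween A B).card = A.card * B.card := by
  rw [pairsBetween, Finset.card_image_of_injOn, Finset.card_product]
  rintro ⟨a, b⟩ hab ⟨a', b'⟩ hab' he
  simp only [Finset.coe_product, Set.mem_prod, Finset.mem_coe] at hab hab'
  rcases Sym2.eq_iff.1 he with ⟨h1, h2⟩ | ⟨h1, h2⟩
  · exact Prod.ext h1 h2
  · exact absurd ((show a = b' from h1) ▸ hab.1) (Finset.disjoint_right.1 h hab'.2)

section Counting

variable [Fintype V] [DecidableEq V] [Fintype Q] [DecidableEq Q]

/-- The colourings without an edge of colour `z` between some two large disjoint sets. -/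
def separatedColourings (V : Type*) [Fintype V] [DecidableEq V] (z : Q) :
    Finset (Sym2 V → Q) :=
  ((Finset.univ : Finset (Finset V × Finset V)).filter fun p => Disjoint p.1 p.2 ∧
    Fintype.card V ≤ 5 * p.1.card ∧ Fintype.card V ≤ 5 * p.2.card).biUnion fun p =>
      Finset.univ.filter fun g => ∀ e ∈ pairsBetween p.1 p.2, g e ∈ ({z} : Finset Q)ᶜ

/-- This is (1 - 1/q)^q ≤ 1/2, from Bernoulli's inequality applied to (1 + 1/(q-1))^q. -/
lemma two_mul_pred_pow_le {q : ℕ} (hq : 0 < q) : 2 * (q - 1) ^ q ≤ q ^ q := by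
  rcases q with _ | _ | q
  · simp at hq
  · simp
  · have h := one_add_mul_le_pow (a := (1 / (q + 1 : ℝ))) (by
      have : (0 : ℝ) ≤ 1 / (q + 1 : ℝ) := by positivity
      linarith) (q + 2)
    have h2 : (2 : ℝ) ≤ (1 + 1 / (q + 1 : ℝ)) ^ (q + 2) := by
      refine le_trans ?_ h
      push_cast
      have : ((q : ℝ) + 2) * (1 / (q + 1)) = 1 + 1 / (q + 1) := by field_simp; ring
      have : (0 : ℝ) ≤ 1 / (q + 1 : ℝ) := by positivity
      linarith
    have h3 : (1 + 1 / (q + 1 : ℝ)) = (q + 2) / (q + 1) := by field_simp; ring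
    rw [h3, div_pow, le_div_iff₀ (by positivity)] at h2
    have : q + 1 + 1 - 1 = q + 1 := rfl
    rw [this]
    exact_mod_cast h2

lemma card_filter_pairsBetween_le (z : Q) (hV : Fintype.card V = 75 * Fintype.card Q)
    {A B : Finset V} (hAB : Disjoint A B) (hA : Fintype.card V ≤ 5 * A.card)
    (hB : Fintype.card V ≤ 5 * B.card) :
    (Finset.univ.filter fun g : Sym2 V → Q =>
        ∀ e ∈ pairsBetween A B, g e ∈ ({z} : Finset Q)ᶜ).card * 8 ^ Fintype.card V ≤
      Fintype.card Q ^ Fintype.card (Sym2 V) := by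
  have hq : 0 < Fintype.card Q := Fintype.card_pos_iff.2 ⟨z⟩
  set q := Fintype.card Q
  set N := Fintype.card V
  -- |A||B| ≥ N²/25 = 3Nq is where 75 comes from: all these pairs miss `z` with probability at most
  -- 2^(-3N) = 8^(-N).
  obtain ⟨F, hF, hFc⟩ := Finset.exists_subset_card_eq (s := pairsBetween A B) (n := 3 * N * q) (by
    rw [card_pairsBetween hAB]
    have : N * N ≤ 25 * (A.card * B.card) := by nlinarith
    nlinarith)
  have hcount := card_filter_forall_mem F (({z} : Finset Q)ᶜ)
  rw [Finset.card_compl, Finset.card_singleton, hFc] at hcount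
  have hmono : (Finset.univ.filter fun g : Sym2 V → Q =>
        ∀ e ∈ pairsBetween A B, g e ∈ ({z} : Finset Q)ᶜ).card ≤
      (Finset.univ.filter fun g : Sym2 V → Q => ∀ e ∈ F, g e ∈ ({z} : Finset Q)ᶜ).card :=
    Finset.card_le_card fun g hg => by
      rw [Finset.mem_filter] at hg ⊢
      exact ⟨hg.1, fun e he => hg.2 e (hF he)⟩
  refine (Nat.mul_le_mul_right _ hmono).trans ?_
  have hpow : 8 ^ N * (q - 1) ^ (3 * N * q) ≤ q ^ (3 * N * q) := by
    have := Nat.pow_le_pow_left (two_mul_pred_pow_le hq) (3 * N)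
    rw [mul_pow, ← pow_mul, ← pow_mul, pow_mul 2 3 N] at this
    rwa [mul_comm (3 * N) q]
  refine Nat.le_of_mul_le_mul_right (c := q ^ (3 * N * q)) ?_ (by positivity)
  calc _ = 8 ^ N * ((Finset.univ.filter fun g : Sym2 V → Q =>
            ∀ e ∈ F, g e ∈ ({z} : Finset Q)ᶜ).card * q ^ (3 * N * q)) := by ring
    _ = (8 ^ N * (q - 1) ^ (3 * N * q)) * q ^ Fintype.card (Sym2 V) := by rw [hcount]; ring
    _ ≤ q ^ (3 * N * q) * q ^ Fintype.card (Sym2 V) := Nat.mul_le_mul_right _ hpow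
    _ = _ := by ring

/-- Union bound: at most 4^N pairs of sets, each failing with probability at most 8^(-N). -/
lemma card_separatedColourings_le (z : Q) (hV : Fintype.card V = 75 * Fintype.card Q) :
    4 * (separatedColourings V z).card ≤ Fintype.card Q ^ Fintype.card (Sym2 V) := by
  have hq : 0 < Fintype.card Q := Fintype.card_pos_iff.2 ⟨z⟩
  have h := Finset.sum_le_card_nsmul
    ((Finset.univ : Finset (Finset V × Finset V)).filter fun p => Disjoint p.1 p.2 ∧
      Fintype.card V ≤ 5 * p.1.card ∧ Fintype.card V ≤ 5 * p.2.card)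
    (fun p => (Finset.univ.filter fun g : Sym2 V → Q =>
        ∀ e ∈ pairsBetween p.1 p.2, g e ∈ ({z} : Finset Q)ᶜ).card * 8 ^ Fintype.card V)
    (Fintype.card Q ^ Fintype.card (Sym2 V)) (fun p hp => by
      rw [Finset.mem_filter] at hp
      exact card_filter_pairsBetween_le z hV hp.2.1 hp.2.2.1 hp.2.2.2)
  rw [← Finset.sum_mul, smul_eq_mul] at h
  have h1 : (separatedColourings V z).card * 8 ^ Fintype.card V ≤
      4 ^ Fintype.card V * Fintype.card Q ^ Fintype.card (Sym2 V) := by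
    refine (Nat.mul_le_mul_right _ Finset.card_biUnion_le).trans (h.trans ?_)
    refine Nat.mul_le_mul_right _ ((Finset.card_filter_le _ _).trans ?_)
    simp [Fintype.card_prod, ← mul_pow]
  have h2 : 4 * 4 ^ Fintype.card V ≤ 8 ^ Fintype.card V := by
    have : (8 : ℕ) ^ Fintype.card V = 2 ^ Fintype.card V * 4 ^ Fintype.card V := by
      rw [← mul_pow]; norm_num
    rw [this]
    refine Nat.mul_le_mul_right _ ?_
    calc 4 = 2 ^ 2 := rfl
      _ ≤ 2 ^ Fintype.card V := Nat.pow_le_pow_right (by norm_num) (by omega)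
  refine Nat.le_of_mul_le_mul_right (c := 4 ^ Fintype.card V) ?_ (by positivity)
  nlinarith

lemma exists_adj_of_notMem_separatedColourings {z : Q} {g : Sym2 V → Q}
    (hg : g ∉ separatedColourings V z) {A B : Finset V} (hAB : Disjoint A B)
    (hA : Fintype.card V ≤ 5 * A.card) (hB : Fintype.card V ≤ 5 * B.card) :
    ∃ a ∈ A, ∃ b ∈ B, (colourGraph z g).Adj a b := by
  by_contra! hcon
  refine hg (Finset.mem_biUnion.2 ⟨(A, B), by simp [hAB, hA, hB], ?_⟩)
  simp only [Finset.mem_filter, Finset.mem_univ, true_and, pairsBetween, Finset.mem_image,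
    Finset.mem_product, Finset.mem_compl, Finset.mem_singleton]
  rintro _ ⟨⟨a, b⟩, ⟨ha, hb⟩, rfl⟩ he
  refine hcon a ha b hb (colourGraph_adj.2 ⟨he, ?_⟩)
  rintro rfl
  exact Finset.disjoint_left.1 hAB ha hb

/-- The cyclically consecutive pairs of a tuple. -/
def closedEdges {m : ℕ} (t : Fin (m + 1) → V) : Finset (Sym2 V) :=
  Finset.univ.image fun i => s(t i, t (i + 1))

/-- The tuples of length at most `L` which run through a cycle all of whose edges have colour `z`
(and degenerate ones in lengths below three). -/
def shortCycles (L : ℕ) (z : Q) (g : Sym2 V → Q) : Finset (Σ m : Fin L, (Fin (m + 1) → V)) :=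
  Finset.univ.filter fun t => (closedEdges t.2).card = t.1 + 1 ∧ ∀ e ∈ closedEdges t.2, g e = z

lemma sum_range_pow_succ_le (L : ℕ) : ∑ m : Fin L, 75 ^ ((m : ℕ) + 1) ≤ 75 ^ (L + 1) := by
  rw [Fin.sum_univ_eq_sum_range (fun m => 75 ^ (m + 1)) L]
  induction L with
  | zero => simp
  | succ L ih =>
    rw [Finset.sum_range_succ, pow_succ 75 (L + 1)]
    omega

/-- Each of the (75q)^(m+1) tuples with distinct edges survives with probability q^(-(m+1)), so
length m+1 contributes at most 75^(m+1) on average. -/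
lemma sum_card_shortCycles_le (L : ℕ) (z : Q) (hV : Fintype.card V = 75 * Fintype.card Q) :
    ∑ g : Sym2 V → Q, (shortCycles L z g).card ≤
      75 ^ (L + 1) * Fintype.card Q ^ Fintype.card (Sym2 V) := by
  have hq : 0 < Fintype.card Q := Fintype.card_pos_iff.2 ⟨z⟩
  simp_rw [shortCycles, Finset.card_filter]
  rw [Finset.sum_comm, ← Finset.univ_sigma_univ, Finset.sum_sigma]
  refine le_trans (Finset.sum_le_sum fun m _ => ?_) (le_trans (Finset.sum_mul _ _ _).ge
    (Nat.mul_le_mul_right _ (sum_range_pow_succ_le L)))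
  refine Nat.le_of_mul_le_mul_right (c := Fintype.card Q ^ ((m : ℕ) + 1)) ?_ (by positivity)
  rw [Finset.sum_mul]
  refine (Finset.sum_le_card_nsmul _ _ (Fintype.card Q ^ Fintype.card (Sym2 V)) fun t _ => ?_).trans
    (le_of_eq ?_)
  · rw [← Finset.card_filter]
    by_cases ht : (closedEdges t).card = m + 1
    · have := card_filter_forall_mem (closedEdges t) {z}
      rw [ht, Finset.card_singleton, one_pow, one_mul] at this
      simp only [ht, true_and, ← this, Finset.mem_singleton, le_refl]
    · simp [ht]
  · rw [Finset.card_univ, Fintype.card_fun, Fintype.card_fin, hV, smul_eq_mul, mul_pow]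
    ring

/-- The first moment method: some colouring has an edge between any two large sets, and few short
cycles. -/
lemma exists_colouring (L : ℕ) (z : Q) (hV : Fintype.card V = 75 * Fintype.card Q) :
    ∃ g : Sym2 V → Q, g ∉ separatedColourings V z ∧
      (shortCycles L z g).card ≤ 2 * 75 ^ (L + 1) := by
  by_contra! hcon
  have hq : 0 < Fintype.card Q := Fintype.card_pos_iff.2 ⟨z⟩
  have h1 := card_separatedColourings_le (V := V) z hV
  have h2 := sum_card_shortCycles_le (V := V) L z hV
  -- Markov's inequality: at most half of the colourings have too many short cycles, and at most a
  -- quarter are separated.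
  have h3 : (separatedColourings V z)ᶜ.card * (2 * 75 ^ (L + 1)) ≤
      ∑ g : Sym2 V → Q, (shortCycles L z g).card := by
    refine le_trans ?_ (Finset.sum_le_sum_of_subset
      (Finset.subset_univ (separatedColourings V z)ᶜ))
    rw [← smul_eq_mul]
    exact Finset.card_nsmul_le_sum _ _ _ fun g hg => (hcon g (Finset.mem_compl.1 hg)).le
  have h4 := Finset.card_add_card_compl (separatedColourings V z)
  rw [Fintype.card_fun] at h4
  have h5 : 0 < Fintype.card Q ^ Fintype.card (Sym2 V) := by positivity
  have h6 : 0 < 75 ^ (L + 1) := by positivity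
  have h7 := h3.trans h2
  rw [← mul_assoc, mul_comm (75 ^ (L + 1))] at h7
  have := Nat.le_of_mul_le_mul_right h7 h6
  omega

end Counting

/-- Disjoint cycles are either short or use up many vertices. -/
lemma HasDisjointCycles.le_of_colourGraph [Fintype V] [DecidableEq V] [Fintype Q] [DecidableEq Q]
    {z : Q} {g : Sym2 V → Q} {k : ℕ} (hk : (colourGraph z g).HasDisjointCycles k) (L : ℕ) :
    (L + 1) * k ≤ (L + 1) * (shortCycles L z g).card + Fintype.card V := by
  obtain ⟨v, C, hC, hCd⟩ := hk
  set short : Finset (Fin k) := Finset.univ.filter fun i => (C i).length ≤ L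
  set long : Finset (Fin k) := Finset.univ.filter fun i => ¬ (C i).length ≤ L
  have hkcard : short.card + long.card = k := by
    rw [Finset.card_filter_add_card_filter_not, Finset.card_univ, Fintype.card_fin]
  have hlong : (L + 1) * long.card ≤ Fintype.card V := by
    have hd : (long : Set (Fin k)).PairwiseDisjoint fun i => (C i).support.tail.toFinset := by
      intro i _ j _ hij
      refine Finset.disjoint_left.2 fun x hx hx' => ?_
      exact hCd i j hij (List.mem_of_mem_tail (List.mem_toFinset.1 hx))
        (List.mem_of_mem_tail (List.mem_toFinset.1 hx'))
    have h1 := Finset.card_biUnion hd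
    have h2 := Finset.card_le_univ (long.biUnion fun i => (C i).support.tail.toFinset)
    rw [h1] at h2
    refine le_trans ?_ h2
    rw [mul_comm, ← smul_eq_mul]
    refine Finset.card_nsmul_le_sum _ _ _ fun i hi => ?_
    rw [List.toFinset_card_of_nodup (hC i).support_nodup, List.length_tail, Walk.length_support]
    have := (Finset.mem_filter.1 hi).2
    omega
  have hshort : short.card ≤ (shortCycles L z g).card := by
    have hlen : ∀ i ∈ short, (C i).length - 1 < L ∧ (C i).length - 1 + 1 = (C i).length := by
      intro i hi
      have h1 := (Finset.mem_filter.1 hi).2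
      have h2 := (hC i).three_le_length
      omega
    -- The first entry of the tuple lies on the cycle, so disjoint cycles get different tuples.
    have hmem : ∀ i ∈ short, ∃ x ∈ shortCycles L z g, x.2 0 ∈ (C i).support := by
      intro i hi
      obtain ⟨h1, h2⟩ := hlen i hi
      obtain ⟨m, hm⟩ : ∃ m, m = (C i).length - 1 := ⟨_, rfl⟩
      rw [← hm] at h1 h2
      have hstep : ∀ j : Fin (m + 1), (C i).getVert ((j + 1 : Fin (m + 1)) : ℕ) =
          (C i).getVert (j + 1) := by
        intro j
        rcases eq_or_ne j (Fin.last m) with rfl | hj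
        · simp [h2]
        · rw [Fin.val_add_one_of_lt (Fin.lt_last_iff_ne_last.2 hj)]
      have hedge : ∀ {u w : V} (p : (colourGraph z g).Walk u w), ∀ e ∈ p.edges,
          ∃ j < p.length, e = s(p.getVert j, p.getVert (j + 1)) := by
        intro u w p
        induction p with
        | nil => simp
        | cons h p ih =>
          intro e he
          rw [Walk.edges_cons, List.mem_cons] at he
          rcases he with rfl | he
          · exact ⟨0, by simp⟩
          · obtain ⟨j, hj, rfl⟩ := ih e he
            exact ⟨j + 1, by simpa using hj, by simp⟩
      refine ⟨⟨⟨m, h1⟩, fun j => (C i).getVert j⟩, ?_, by simp⟩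
      rw [shortCycles, Finset.mem_filter]
      refine ⟨Finset.mem_univ _, le_antisymm ?_ ?_, ?_⟩
      · exact Finset.card_image_le.trans (by simp)
      · show m + 1 ≤ _
        have h3 : (C i).edges.toFinset.card = m + 1 := by
          rw [List.toFinset_card_of_nodup (hC i).edges_nodup, Walk.length_edges, h2]
        refine h3.ge.trans (Finset.card_le_card fun e he => ?_)
        obtain ⟨j, hj, rfl⟩ := hedge _ e (List.mem_toFinset.1 he)
        refine Finset.mem_image.2 ⟨⟨j, h2 ▸ hj⟩, Finset.mem_univ _, ?_⟩
        dsimp only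
        rw [hstep]
      · intro e he
        obtain ⟨j, -, rfl⟩ := Finset.mem_image.1 he
        dsimp only
        rw [hstep]
        exact (colourGraph_adj.1 ((C i).adj_getVert_succ (by rw [← h2]; exact j.2))).1
    rcases short.eq_empty_or_nonempty with h0 | ⟨i₀, hi₀⟩
    · simp [h0]
    have : Nonempty (Σ m : Fin L, (Fin (m + 1) → V)) := ⟨(hmem i₀ hi₀).choose⟩
    choose! φ hφ hφ' using hmem
    refine Finset.card_le_card_of_injOn φ hφ fun i hi j hj hij => ?_
    by_contra hne
    exact hCd i j hne (hφ' i hi) (hij ▸ hφ' j hj)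
  nlinarith

end SimpleGraph

/-! ### Choice of parameters and conclusion -/

namespace SimpleGraph

/-- There are graphs on `N` vertices, for arbitrarily large `N`, with treewidth at least `N / 75`
and at most `O(N / log N)` disjoint cycles. -/
lemma exists_treewidth_ge_of_few_disjoint_cycles {q : ℕ} (hq : 0 < q) :
    ∃ G : SimpleGraph (Fin (75 * q)), (q : ℕ∞) ≤ G.treewidth ∧
      ∀ k, G.HasDisjointCycles k → (k : ℝ) * Real.log (75 * q : ℕ) ≤ 450 * (75 * q : ℕ) := by
  have hV : Fintype.card (Fin (75 * q)) = 75 * Fintype.card (Fin q) := by simp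
  set N := 75 * q with hN
  -- The base 75² gives 75^L ≤ √N, while L + 1 is still at least log N / 150.
  set L := Nat.log (75 ^ 2) N with hL
  obtain ⟨g, hg, hshort⟩ := exists_colouring (V := Fin N) L (⟨0, hq⟩ : Fin q) hV
  refine ⟨colourGraph ⟨0, hq⟩ g, ?_, fun k hk => ?_⟩
  · by_contra! hlt
    obtain ⟨D, hD⟩ := iInf_lt_iff.1 hlt
    obtain ⟨A, B, hAB, hno, hA, hB⟩ := D.exists_separated fun t => by
      have h1 : (D.bag t).encard - 1 < q := (le_iSup _ t).trans_lt hD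
      -- Despite the truncated subtraction this gives |bag| ≤ q, well below N/10 = 7.5q.
      have h2 : (D.bag t).ncard - 1 < q := by
        rw [← (Set.toFinite (D.bag t)).cast_ncard_eq] at h1
        exact_mod_cast h1
      rw [Fintype.card_fin]
      omega
    obtain ⟨a, ha, b, hb, hab⟩ := exists_adj_of_notMem_separatedColourings hg hAB hA hB
    exact hno a ha b hb hab
  · have hN0 : 0 < N := by omega
    have hNR : (0 : ℝ) < N := by exact_mod_cast hN0
    have h1 := hk.le_of_colourGraph L
    rw [Fintype.card_fin] at h1
    have h2 : (L + 1) * k ≤ (L + 1) * (2 * 75 ^ (L + 1)) + N :=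
      h1.trans (Nat.add_le_add_right (Nat.mul_le_mul_left _ hshort) _)
    have h2R : ((L : ℝ) + 1) * k ≤ (L + 1) * (2 * 75 ^ (L + 1)) + N := by exact_mod_cast h2
    have hpow : (75 : ℝ) ^ L ≤ √N := by
      refine Real.le_sqrt_of_sq_le ?_
      rw [← pow_mul, mul_comm, pow_mul]
      exact_mod_cast Nat.pow_log_le_self (75 ^ 2) hN0.ne'
    have hlog : Real.log N ≤ 150 * (L + 1) := by
      have h3 : (N : ℝ) ≤ (75 ^ 2) ^ (L + 1) := by
        exact_mod_cast (Nat.lt_pow_succ_log_self (b := 75 ^ 2) (by norm_num) N).le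
      refine (Real.log_le_log hNR h3).trans ?_
      rw [Real.log_pow, Real.log_pow]
      have := Real.log_le_self (show (0 : ℝ) ≤ 75 by norm_num)
      push_cast
      nlinarith [(Nat.cast_nonneg L : (0 : ℝ) ≤ L)]
    have hlog0 : 0 ≤ Real.log N := Real.log_natCast_nonneg N
    have hsqrt : √N * Real.log N ≤ 2 * N := by
      have h4 := Real.log_le_self (Real.sqrt_nonneg (N : ℝ))
      rw [Real.log_sqrt hNR.le] at h4
      nlinarith [Real.mul_self_sqrt hNR.le, Real.sqrt_nonneg (N : ℝ)]
    have hL0 : (0 : ℝ) < L + 1 := by positivity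
    have hk' : (k : ℝ) ≤ 150 * √N + N / (L + 1) := by
      have h5 : (k : ℝ) ≤ 2 * 75 ^ (L + 1) + N / (L + 1) := by
        rw [← sub_le_iff_le_add', le_div_iff₀ hL0]
        linarith
      rw [pow_succ] at h5
      linarith
    calc (k : ℝ) * Real.log N ≤ (150 * √N + N / (L + 1)) * Real.log N :=
          mul_le_mul_of_nonneg_right hk' hlog0
      _ = 150 * (√N * Real.log N) + N / (L + 1) * Real.log N := by ring
      _ ≤ 150 * (2 * N) + N / (L + 1) * (150 * (L + 1)) := by gcongr
      _ = 450 * N := by field_simp; ring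

end SimpleGraph

theorem mainTheorem8 :
    ∀ c : ℝ, 0 < c → ∃ d : ℝ, 0 < d ∧
      ∀ (V : Type*) [Fintype V] (H : SimpleGraph V), 2 ≤ Fintype.card V →
        (H.minorTreewidthBound : ℝ≥0∞) ≤ ENNReal.ofReal (c * (Fintype.card V : ℝ)) →
        ∀ k : ℕ, H.HasDisjointCycles k →
          (k : ℝ) ≤ d * (Fintype.card V : ℝ) / Real.log (Fintype.card V : ℝ) := by
  intro c hc
  refine ⟨450 * (75 * (c + 2)), by positivity, fun V _ H hV hf k hk => ?_⟩
  set n := Fintype.card V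
  have hn : (2 : ℝ) ≤ n := by exact_mod_cast hV
  -- Large enough for q > cn and q ≥ n (so log n ≤ log 75q), yet at most (c + 2)n.
  set q := ⌈(c + 1) * n⌉₊ with hqdef
  have hq1 : (c + 1) * n ≤ q := Nat.le_ceil _
  have hq2 : (q : ℝ) < (c + 1) * n + 1 := Nat.ceil_lt_add_one (by positivity)
  have hqn : (n : ℝ) ≤ q := by nlinarith
  have hq : 0 < q := by
    have : (0 : ℝ) < q := by linarith
    exact_mod_cast this
  obtain ⟨G, hG, hGk⟩ := SimpleGraph.exists_treewidth_ge_of_few_disjoint_cycles hq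
  have hminor : H.IsMinor G := by
    by_contra hno
    have hle : G.treewidth ≤ H.minorTreewidthBound :=
      le_sInf fun b hb => hb _ G hno
    have h1 : ((q : ℕ∞) : ℝ≥0∞) ≤ ENNReal.ofReal (c * n) :=
      (ENat.toENNReal_le.2 (hG.trans hle)).trans hf
    rw [ENat.toENNReal_coe, ← ENNReal.ofReal_natCast,
      ENNReal.ofReal_le_ofReal_iff (by positivity)] at h1
    nlinarith
  have h := hGk k (hminor.hasDisjointCycles hk)
  rw [le_div_iff₀ (Real.log_pos (by linarith))]
  push_cast at h
  have hlog : Real.log n ≤ Real.log (75 * q) := Real.log_le_log (by linarith) (by linarith)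
  calc (k : ℝ) * Real.log n ≤ k * Real.log (75 * q) := by gcongr
    _ ≤ 450 * (75 * q) := h
    _ ≤ 450 * (75 * (c + 2)) * n := by nlinarith
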